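/- Let $B\ge 1$, $\gamma>0$, $R>0$, and let $\Omega_z=\mathcal S_{\mathrm p}\times\cdots\times\mathcal S_{\mathrm p}=\mathcal S_{\mathrm p}^B$ be the Cartesian product of $B$ copies of a finite non-empty one-dimensional (real or complex) constellation $\mathcal S_{\mathrm p}\subset\mathbb C$. Consider the block fading channel without precoding $$Y_b=\alpha_b X_b+W_b,\qquad b=1,\dots,B,$$ where $\mathbf X=(X_1,\dots,X_B)$ is uniformly distributed over $\Omega_z$, the noise variables $W_b\sim\mathcal{CN}(0,2\sigma^2)$ are i.i.d. and independent of $\mathbf X$, $\gamma=\frac1{2\sigma^2}$, and $\boldsymbol\alpha=(\alpha_1,\dots,\alpha_B)\in[0,\infty)^B$ is the fading point. Let $I(\boldsymbol\alpha,\gamma)=\frac1B I(\mathbf X;\mathbf Y\mid\boldsymbol\alpha,\gamma)$ (in bits) and define the outage region and the outage boundary $$V_{\mathrm o}=\{\boldsymbol\alpha\in[0,\infty)^B : I(\boldsymbol\alpha,\gamma)<R\},\qquad B_{\mathrm o}=\{\boldsymbol\alpha\in[0,\infty)^B : I(\boldsymbol\alpha,\gamma)=R\}.$$ For $a\ge 0$,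 let $\boldsymbol\alpha_b(a)$ be the point whose $b$-th coordinate is $a$ and whose other coordinates are $0$. Say that the hypersphere $\sum_b\alpha_b^2=c$ outer bounds (inner bounds) $V_{\mathrm o}$ if the region $\{\boldsymbol\alpha\in[0,\infty)^B:\sum_b\alpha_b^2<c\}$ contains (is contained in) $V_{\mathrm o}$, and that it touches $V_{\mathrm o}$ at a point if that point lies on the hypersphere and on $B_{\mathrm o}$ and is a limit of points of $V_{\mathrm o}$. (i) If $\alpha_{\mathrm o}\in[0,\infty)$ is such that $\boldsymbol\alpha_{b_0}(\alpha_{\mathrm o})\in B_{\mathrm o}$ for some $b_0$, then $V_{\mathrm o}$ is outer bounded by the hypersphere $\alpha_1^2+\cdots+\alpha_B^2=\alpha_{\mathrm o}^2$, which touches it on every axis, at the points $\boldsymbol\alpha_b(\alpha_{\mathrm o})$, $b=1,\dots,B$. (ii) If $\alpha_{\mathrm e}\in[0,\infty)$ is such that $\boldsymbol\alpha_{\mathrm e}=(\alpha_{\mathrm e},\dots,\alpha_{\mathrm e})\in B_{\mathrm o}$, then $V_{\mathrm o}$ is inner bounded by the hypersphere $\alpha_1^2+\cdots+\alpha_B^2=B\alpha_{\mathrm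 e}^2$, which touches it at $\boldsymbol\alpha_{\mathrm e}$. -/

import Mathlib

open MeasureTheory ProbabilityTheory

namespace BlockFading

noncomputable section

/-- Mutual information (in bits) between the two components of a random pair with joint law `μ`:
the Kullback-Leibler divergence of the joint law from the product of its marginals. -/
def mutualInfoBits {𝓧 𝓨 : Type*} [MeasurableSpace 𝓧] [MeasurableSpace 𝓨]
    (μ : Measure (𝓧 × 𝓨)) : ℝ :=
  (InformationTheory.klDiv μ (μ.fst.prod μ.snd)).toReal / Real.log 2

/-- The circularly symmetric complex Gaussian law `CN(0, 2σ²)` with `γ = 1 / (2σ²)`: real and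
imaginary parts are independent real Gaussians with mean `0` and variance `σ² = 1 / (2γ)`. -/
def complexNoise (γ : ℝ) : Measure ℂ :=
  ((gaussianReal 0 (Real.toNNReal (1 / (2 * γ)))).prod
    (gaussianReal 0 (Real.toNNReal (1 / (2 * γ))))).map (fun p : ℝ × ℝ => (⟨p.1, p.2⟩ : ℂ))

/-- Joint law of `(X, Y)`, where `X` is uniformly distributed over the alphabet `Ω ⊆ ℂ^B`,
the noise vector `W` is independent of `X` and has i.i.d. components, and
`Y_b = α_b X_b + W_b` for every block `b`. -/
def channelLaw {B : ℕ} (Ω : Set (Fin B → ℂ)) (γ : ℝ) (α : Fin B → ℝ) :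
    Measure ((Fin B → ℂ) × (Fin B → ℂ)) :=
  ((uniformOn Ω).prod (Measure.pi fun _ : Fin B => complexNoise γ)).map
    (fun p => (p.1, fun b => (α b : ℂ) * p.1 b + p.2 b))

/-- Instantaneous mutual information `I(α, γ) = (1 / B) I(X; Y | α, γ)`, in bits per channel use,
of the block fading channel with fading point `α`, average signal-to-noise ratio `γ` and
transmitted constellation `Ω`. -/
def instMutualInfo {B : ℕ} (Ω : Set (Fin B → ℂ)) (γ : ℝ) (α : Fin B → ℝ) : ℝ :=
  (1 / (B : ℝ)) * mutualInfoBits (channelLaw Ω γ α)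

/-- The fading space: vectors of nonnegative fading gains. -/
def fadingSpace (B : ℕ) : Set (Fin B → ℝ) := {α | ∀ b, 0 ≤ α b}

/-- The outage region `V_o`. -/
def outageRegion {B : ℕ} (Ω : Set (Fin B → ℂ)) (γ R : ℝ) : Set (Fin B → ℝ) :=
  {α | α ∈ fadingSpace B ∧ instMutualInfo Ω γ α < R}

/-- The outage boundary `B_o`. -/
def outageBoundary {B : ℕ} (Ω : Set (Fin B → ℂ)) (γ R : ℝ) : Set (Fin B → ℝ) :=
  {α | α ∈ fadingSpace B ∧ instMutualInfo Ω γ α = R}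

/-- The part in the fading space of the hypersphere `∑ α_b² = c`. -/
def hypersphere (B : ℕ) (c : ℝ) : Set (Fin B → ℝ) :=
  {α | α ∈ fadingSpace B ∧ ∑ b, α b ^ 2 = c}

/-- The region of the fading space limited by the hypersphere `∑ α_b² = c`. -/
def hypersphereRegion (B : ℕ) (c : ℝ) : Set (Fin B → ℝ) :=
  {α | α ∈ fadingSpace B ∧ ∑ b, α b ^ 2 < c}

/-- The hypersphere `∑ α_b² = c` outer bounds the region `V`. -/
def OuterBounds {B : ℕ} (c : ℝ) (V : Set (Fin B → ℝ)) : Prop := V ⊆ hypersphereRegion B c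

/-- The hypersphere `∑ α_b² = c` inner bounds the region `V`. -/
def InnerBounds {B : ℕ} (c : ℝ) (V : Set (Fin B → ℝ)) : Prop := hypersphereRegion B c ⊆ V

/-- The hypersphere `∑ α_b² = c` touches the outage region at the point `p`: `p` lies on the
hypersphere and on the outage boundary, and it is a limit of points of the outage region. -/
def TouchesAt {B : ℕ} (Ω : Set (Fin B → ℂ)) (γ R c : ℝ) (p : Fin B → ℝ) : Prop :=
  p ∈ hypersphere B c ∧ p ∈ outageBoundary Ω γ R ∧ p ∈ closure (outageRegion Ω γ R)

/-- The point on the `b`-th axis of the fading space at distance `a` from the origin. -/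
def axisPoint {B : ℕ} (b : Fin B) (a : ℝ) : Fin B → ℝ := Pi.single b a

/-- The point on the ergodic line `α_1 = ⋯ = α_B` with all components equal to `a`. -/
def ergodicPoint (B : ℕ) (a : ℝ) : Fin B → ℝ := fun _ => a

/-- `Ω` is a Cartesian product of one-dimensional constellations. -/
def IsCartesianProduct {B : ℕ} (Ω : Set (Fin B → ℂ)) : Prop :=
  ∃ S : Fin B → Set ℂ, Ω = Set.univ.pi S

/-- The projections of `Ω` on all coordinate axes yield the same set of points. -/
def HasEqualProjections {B : ℕ} (Ω : Set (Fin B → ℂ)) : Prop :=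
  ∀ b b' : Fin B, (fun x : Fin B → ℂ => x b) '' Ω = (fun x : Fin B → ℂ => x b') '' Ω

end

end BlockFading

/-!
Since the alphabet is a Cartesian product, the information of the block fading channel splits as
`∑ b, f (α b ^ 2)` up to normalization, where `f = blockInfo γ c` is the information of one block
as a function of the squared gain (`instMutualInfo_eq`). The outage region is therefore a sublevel
set of this sum, and everything follows from three properties of `f` on `[0, ∞)`: `f 0 = 0`,
`f` is strictly increasing as soon as the constellation has two points (`strictMonoOn_blockInfo`),
and `f (s + u + v) + f s ≤ f (s + u) + f (s + v)` (`blockInfo_add_le`), which is a form of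
concavity. With `s = 0` the last property makes `f` subadditive, so `∑ b, f (α b ^ 2)` is at
least its value at the axis point of the same norm; by smoothing it also gives Jensen's inequality
with equal weights (`sum_apply_le_card_mul_apply`), so the sum is at most its value at the ergodic
point of the same norm. Strict monotonicity shows that the axis and ergodic points are limits of
points in outage.

The properties of `f` need neither derivatives nor the minimum mean square error. Observations of
one symbol with squared gains `s` and `u` and independent noises can be rotated into one
observation with squared gain `s + u` and pure noise (`channelInfo_prod_fadingChannel`, maximal
ratio combining), so an increase of `f` is the information brought by a further conditionally
independent observation. Such information decreases when more is already observed, because of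
`I(Z; W | Y) ≥ 0` (`channelInfo_prod_add_le`), and it is positive if the law of the
observation depends on the symbol (`channelInfo_lt_prod`).

Mutual information is handled through positive output densities. For a finite alphabet all the
integrals involved converge automatically (`IsDensityFamily.integrable_mul_log`), and
`toReal_klDiv_eq_channelInfo` identifies the resulting formula with the Kullback-Leibler
divergence.
-/

namespace BlockFading

/-! ### Information of a channel given by densities -/

/-- The averaged output density of a channel with a uniformly distributed input in the finite
alphabet `ι`, where `L x` is the output density given the input `x`. -/
noncomputable def mixture {ι 𝓨 : Type*} [Fintype ι] (L : ι → 𝓨 → ℝ) (y : 𝓨) : ℝ :=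
  (Fintype.card ι : ℝ)⁻¹ * ∑ x, L x y

/-- The mutual information, in nats, between a uniformly distributed input in the finite alphabet
`ι` and the output of the channel whose transition densities with respect to `ν` are `L x`. -/
noncomputable def channelInfo {ι 𝓨 : Type*} [Fintype ι] [MeasurableSpace 𝓨] (ν : Measure 𝓨)
    (L : ι → 𝓨 → ℝ) : ℝ :=
  (Fintype.card ι : ℝ)⁻¹ * ∑ x, ∫ y, L x y * Real.log (L x y / mixture L y) ∂ν

/-- `L` is a family of everywhere positive probability densities with respect to `ν`. -/
structure IsDensityFamily {ι 𝓨 : Type*} [MeasurableSpace 𝓨] (ν : Measure 𝓨)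
    (L : ι → 𝓨 → ℝ) : Prop where
  pos : ∀ x y, 0 < L x y
  measurable : ∀ x, Measurable (L x)
  integrable : ∀ x, Integrable (L x) ν
  integral_eq_one : ∀ x, ∫ y, L x y ∂ν = 1

/-- The channel that uses `L` and `K` once each with the same input and independent noises. -/
def prodChannel {ι 𝓨 𝓩 : Type*} (L : ι → 𝓨 → ℝ) (K : ι → 𝓩 → ℝ) (x : ι) (p : 𝓨 × 𝓩) : ℝ :=
  L x p.1 * K x p.2

lemma card_mul_mixture {ι 𝓨 : Type*} [Fintype ι] [Nonempty ι] (L : ι → 𝓨 → ℝ) (y : 𝓨) :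
    (Fintype.card ι : ℝ) * mixture L y = ∑ x, L x y := by
  have : (Fintype.card ι : ℝ) ≠ 0 := by exact_mod_cast Fintype.card_ne_zero
  rw [mixture, mul_inv_cancel_left₀ this]

section Basic

variable {ι 𝓨 𝓩 : Type*} [MeasurableSpace 𝓨] [MeasurableSpace 𝓩] {ν : Measure 𝓨} {κ : Measure 𝓩}
  {L : ι → 𝓨 → ℝ} {K : ι → 𝓩 → ℝ}

lemma IsDensityFamily.prod [SFinite ν] [SFinite κ] (hL : IsDensityFamily ν L)
    (hK : IsDensityFamily κ K) : IsDensityFamily (ν.prod κ) (prodChannel L K) where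
  pos x p := mul_pos (hL.pos x p.1) (hK.pos x p.2)
  measurable x := ((hL.measurable x).comp measurable_fst).mul
    ((hK.measurable x).comp measurable_snd)
  integrable x := (hL.integrable x).mul_prod (hK.integrable x)
  integral_eq_one x := by
    simp only [prodChannel]
    rw [integral_prod_mul, hL.integral_eq_one, hK.integral_eq_one, one_mul]

variable [Fintype ι]

lemma IsDensityFamily.measurable_mixture (hL : IsDensityFamily ν L) :
    Measurable (mixture L) :=
  (Finset.measurable_sum _ fun x _ => hL.measurable x).const_mul _

lemma IsDensityFamily.integrable_mixture (hL : IsDensityFamily ν L) :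
    Integrable (mixture L) ν :=
  (integrable_finsetSum _ fun x _ => hL.integrable x).const_mul _

/-- Relabelling the output by a measure-preserving bijection does not change the information. -/
lemma channelInfo_comp_equiv {e : 𝓨 ≃ᵐ 𝓩} (he : MeasurePreserving e ν κ) (K : ι → 𝓩 → ℝ) :
    channelInfo ν (fun x y => K x (e y)) = channelInfo κ K := by
  unfold channelInfo
  congr 1
  refine Finset.sum_congr rfl fun x _ => ?_
  exact he.integral_comp' (fun z => K x z * Real.log (K x z / mixture K z))

/-- An additional output that is independent of the input carries no information. -/
lemma channelInfo_mul_common [SFinite ν] [SFinite κ] (L : ι → 𝓨 → ℝ) {q : 𝓩 → ℝ}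
    (hq : ∀ z, 0 < q z) (hq1 : ∫ z, q z ∂κ = 1) :
    channelInfo (ν.prod κ) (fun x p => L x p.1 * q p.2) = channelInfo ν L := by
  unfold channelInfo
  congr 1
  refine Finset.sum_congr rfl fun x _ => ?_
  rw [← mul_one (∫ y, L x y * Real.log (L x y / mixture L y) ∂ν), ← hq1, ← integral_prod_mul]
  refine integral_congr_ae (Filter.Eventually.of_forall fun p => ?_)
  have h : mixture (fun x (p : 𝓨 × 𝓩) => L x p.1 * q p.2) p = mixture L p.1 * q p.2 := by
    simp only [mixture, ← Finset.sum_mul, mul_assoc]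
  simp only [h]
  rw [mul_div_mul_right _ _ (hq p.2).ne']
  ring

variable [Nonempty ι]

lemma inv_card_mul_sum_const (c : ℝ) :
    (Fintype.card ι : ℝ)⁻¹ * ∑ _x : ι, c = c := by
  have : (Fintype.card ι : ℝ) ≠ 0 := by exact_mod_cast Fintype.card_ne_zero
  simp [this]

lemma IsDensityFamily.mixture_pos (hL : IsDensityFamily ν L) (y : 𝓨) : 0 < mixture L y :=
  mul_pos (by positivity) (Finset.sum_pos (fun x _ => hL.pos x y) Finset.univ_nonempty)

lemma IsDensityFamily.le_card_mul_mixture (hL : IsDensityFamily ν L) (x : ι) (y : 𝓨) :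
    L x y ≤ Fintype.card ι * mixture L y := by
  rw [card_mul_mixture]
  exact Finset.single_le_sum (f := fun x => L x y) (fun x _ => (hL.pos x y).le)
    (Finset.mem_univ x)

lemma IsDensityFamily.integral_mixture (hL : IsDensityFamily ν L) :
    ∫ y, mixture L y ∂ν = 1 := by
  simp only [mixture]
  rw [integral_const_mul, integral_finsetSum _ fun x _ => hL.integrable x]
  simp only [hL.integral_eq_one]
  exact inv_card_mul_sum_const 1

/-- The information density is bounded above by `log |ι|`, and its negative part is controlled
by `log t ≥ 1 - 1 / t`; hence its expectation exists without any moment condition. -/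
lemma IsDensityFamily.integrable_mul_log (hL : IsDensityFamily ν L) (x : ι) :
    Integrable (fun y => L x y * Real.log (L x y / mixture L y)) ν := by
  have hcard : (1 : ℝ) ≤ Fintype.card ι := by exact_mod_cast Fintype.card_pos
  refine Integrable.mono' (g := fun y => L x y * Real.log (Fintype.card ι) + L x y + mixture L y)
    ((((hL.integrable x).mul_const _).add (hL.integrable x)).add hL.integrable_mixture)
    ((hL.measurable x).mul
      ((hL.measurable x).div hL.measurable_mixture).log).aestronglyMeasurable
    (Filter.Eventually.of_forall fun y => ?_)
  have h1 := hL.pos x y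
  have h2 := hL.mixture_pos y
  have h3 : Real.log (L x y / mixture L y) ≤ Real.log (Fintype.card ι) :=
    Real.log_le_log (by positivity) ((div_le_iff₀ h2).2 (hL.le_card_mul_mixture x y))
  have h4 := Real.one_sub_inv_le_log_of_pos (div_pos h1 h2)
  have h5 := mul_le_mul_of_nonneg_left h4 h1.le
  have h6 := mul_le_mul_of_nonneg_left h3 h1.le
  have h7 : L x y * (1 - (L x y / mixture L y)⁻¹) = L x y - mixture L y := by
    field_simp
  have h8 : 0 ≤ L x y * Real.log (Fintype.card ι) :=
    mul_nonneg h1.le (Real.log_nonneg hcard)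
  rw [Real.norm_eq_abs, abs_le]
  constructor <;> linarith

lemma IsDensityFamily.integrable_mul_div_mixture (hL : IsDensityFamily ν L) (x x' : ι) :
    Integrable (fun y => L x y * L x' y / mixture L y) ν := by
  refine Integrable.mono' (g := fun y => L x y * Fintype.card ι)
    ((hL.integrable x).mul_const _)
    (((hL.measurable x).mul (hL.measurable x')).div hL.measurable_mixture).aestronglyMeasurable
    (Filter.Eventually.of_forall fun y => ?_)
  have h1 := hL.pos x y
  have h1' := hL.pos x' y
  have h2 := hL.mixture_pos y
  rw [Real.norm_of_nonneg (by positivity), div_le_iff₀ h2, mul_assoc]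
  exact mul_le_mul_of_nonneg_left (hL.le_card_mul_mixture x' y) h1.le

lemma IsDensityFamily.sum_sum_integral_mul_div_mixture (hL : IsDensityFamily ν L) :
    (Fintype.card ι : ℝ)⁻¹ * ∑ x, (Fintype.card ι : ℝ)⁻¹ * ∑ x',
      ∫ y, L x y * L x' y / mixture L y ∂ν = 1 := by
  simp_rw [← integral_finsetSum Finset.univ fun x' _ => hL.integrable_mul_div_mixture _ x',
    ← integral_const_mul]
  have h (x : ι) (y : 𝓨) : (Fintype.card ι : ℝ)⁻¹ * ∑ x', L x y * L x' y / mixture L y = L x y := by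
    have h2 := (hL.mixture_pos y).ne'
    have h3 : (Fintype.card ι : ℝ) ≠ 0 := by exact_mod_cast Fintype.card_ne_zero
    rw [← Finset.sum_div, ← Finset.mul_sum, ← card_mul_mixture]
    field_simp
  simp_rw [h, hL.integral_eq_one]
  exact inv_card_mul_sum_const 1

lemma channelInfo_eq_zero_of_common {q : 𝓨 → ℝ} (hq : ∀ y, 0 < q y) :
    channelInfo ν (fun _ : ι => q) = 0 := by
  have h (y : 𝓨) : mixture (fun _ : ι => q) y = q y := inv_card_mul_sum_const (q y)
  simp only [channelInfo, h]
  simp [div_self (hq _).ne']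

end Basic

/-- The measurable bijection that exchanges the last two of three outputs. -/
def prodRightComm (𝓨 𝓩 𝓦 : Type*) [MeasurableSpace 𝓨] [MeasurableSpace 𝓩] [MeasurableSpace 𝓦] :
    (𝓨 × 𝓩) × 𝓦 ≃ᵐ (𝓨 × 𝓦) × 𝓩 where
  toFun p := ((p.1.1, p.2), p.1.2)
  invFun p := ((p.1.1, p.2), p.1.2)
  left_inv _ := rfl
  right_inv _ := rfl
  measurable_toFun := by simp only [Equiv.coe_fn_mk]; fun_prop
  measurable_invFun := by simp only [Equiv.coe_fn_symm_mk]; fun_prop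

lemma measurePreserving_prodRightComm {𝓨 𝓩 𝓦 : Type*} [MeasurableSpace 𝓨] [MeasurableSpace 𝓩]
    [MeasurableSpace 𝓦] (ν : Measure 𝓨) (κ : Measure 𝓩) (ρ : Measure 𝓦) [SFinite ν] [SFinite κ]
    [SFinite ρ] :
    MeasurePreserving (prodRightComm 𝓨 𝓩 𝓦) ((ν.prod κ).prod ρ) ((ν.prod ρ).prod κ) :=
  (measurePreserving_prodAssoc ν ρ κ).symm.comp
    (((MeasurePreserving.id ν).prod Measure.measurePreserving_swap).comp
      (measurePreserving_prodAssoc ν κ ρ))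

/-! ### Submodularity and strict monotonicity in the observations -/

section Inequalities

variable {ι 𝓨 𝓩 𝓦 : Type*} [Fintype ι] [Nonempty ι] [MeasurableSpace 𝓨] [MeasurableSpace 𝓩]
  [MeasurableSpace 𝓦] {ν : Measure 𝓨} {κ : Measure 𝓩} {ρ : Measure 𝓦} [SFinite ν] [SFinite κ]
  [SFinite ρ] {L : ι → 𝓨 → ℝ} {K : ι → 𝓩 → ℝ} {T : ι → 𝓦 → ℝ}

/-- Two outputs that are independent given the input and a side observation `Y` satisfy
`I(X; Y, Z, W) - I(X; Y, Z) ≤ I(X; Y, W) - I(X; Y)`: the gap is `I(Z; W | Y) ≥ 0`, here bounded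
below by `log t ≤ t - 1`. -/
theorem channelInfo_prod_add_le (hL : IsDensityFamily ν L) (hK : IsDensityFamily κ K)
    (hT : IsDensityFamily ρ T) :
    channelInfo ((ν.prod κ).prod ρ) (prodChannel (prodChannel L K) T) + channelInfo ν L ≤
      channelInfo (ν.prod κ) (prodChannel L K) + channelInfo (ν.prod ρ) (prodChannel L T) := by
  set m := mixture L
  set mK := mixture (prodChannel L K) with hmK
  set mT := mixture (prodChannel L T) with hmT
  set mKT := mixture (prodChannel (prodChannel L K) T)
  have hLK := hL.prod hK
  have hLT := hL.prod hT
  have hLKT := hLK.prod hT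
  -- The outputs are reordered so that `(Y, W)` comes first.
  let e := prodRightComm 𝓨 𝓩 𝓦
  have he := measurePreserving_prodRightComm ν κ ρ
  -- The four information densities, integrated over the joint law of all outputs.
  let G (x : ι) (p : (𝓨 × 𝓩) × 𝓦) : ℝ :=
    prodChannel (prodChannel L K) T x p *
      Real.log (prodChannel (prodChannel L K) T x p / mKT p)
  let G0 (x : ι) (p : (𝓨 × 𝓩) × 𝓦) : ℝ :=
    (L x p.1.1 * Real.log (L x p.1.1 / m p.1.1)) * K x p.1.2 * T x p.2
  let G1 (x : ι) (p : (𝓨 × 𝓩) × 𝓦) : ℝ :=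
    (prodChannel L K x p.1 * Real.log (prodChannel L K x p.1 / mK p.1)) * T x p.2
  let H2 (x : ι) (p : (𝓨 × 𝓦) × 𝓩) : ℝ :=
    (prodChannel L T x p.1 * Real.log (prodChannel L T x p.1 / mT p.1)) * K x p.2
  let G2 (x : ι) (p : (𝓨 × 𝓩) × 𝓦) : ℝ := H2 x (e p)
  have iG (x : ι) : Integrable (G x) ((ν.prod κ).prod ρ) := hLKT.integrable_mul_log x
  have iG0 (x : ι) : Integrable (G0 x) ((ν.prod κ).prod ρ) :=
    ((hL.integrable_mul_log x).mul_prod (hK.integrable x)).mul_prod (hT.integrable x)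
  have iG1 (x : ι) : Integrable (G1 x) ((ν.prod κ).prod ρ) :=
    (hLK.integrable_mul_log x).mul_prod (hT.integrable x)
  have iG2 (x : ι) : Integrable (G2 x) ((ν.prod κ).prod ρ) :=
    (he.integrable_comp_emb e.measurableEmbedding).2
      ((hLT.integrable_mul_log x).mul_prod (hK.integrable x))
  have eG0 (x : ι) : ∫ p, G0 x p ∂((ν.prod κ).prod ρ) =
      ∫ y, L x y * Real.log (L x y / m y) ∂ν := by
    have := integral_prod_mul (μ := ν.prod κ) (ν := ρ)
      (fun q : 𝓨 × 𝓩 => (L x q.1 * Real.log (L x q.1 / m q.1)) * K x q.2) (T x)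
    rw [hT.integral_eq_one, mul_one,
      integral_prod_mul (fun y => L x y * Real.log (L x y / m y)) (K x),
      hK.integral_eq_one, mul_one] at this
    exact this
  have eG1 (x : ι) : ∫ p, G1 x p ∂((ν.prod κ).prod ρ) =
      ∫ y, prodChannel L K x y * Real.log (prodChannel L K x y / mK y) ∂(ν.prod κ) := by
    have := integral_prod_mul (μ := ν.prod κ) (ν := ρ)
      (fun q : 𝓨 × 𝓩 => prodChannel L K x q * Real.log (prodChannel L K x q / mK q)) (T x)
    rwa [hT.integral_eq_one, mul_one] at this
  have eG2 (x : ι) : ∫ p, G2 x p ∂((ν.prod κ).prod ρ) =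
      ∫ y, prodChannel L T x y * Real.log (prodChannel L T x y / mT y) ∂(ν.prod ρ) := by
    have := integral_prod_mul (μ := ν.prod ρ) (ν := κ)
      (fun q : 𝓨 × 𝓦 => prodChannel L T x q * Real.log (prodChannel L T x q / mT q)) (K x)
    rw [hK.integral_eq_one, mul_one] at this
    rw [← this]
    exact he.integral_comp' (H2 x)
  -- The majorant coming from `log t ≤ t - 1`.
  let c : ℝ := (Fintype.card ι : ℝ)⁻¹
  let D (x x' : ι) (p : (𝓨 × 𝓩) × 𝓦) : ℝ :=
    (L x p.1.1 * L x' p.1.1 / m p.1.1) * K x p.1.2 * T x' p.2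
  have iD (x x' : ι) : Integrable (D x x') ((ν.prod κ).prod ρ) :=
    ((hL.integrable_mul_div_mixture x x').mul_prod (hK.integrable x)).mul_prod (hT.integrable x')
  have eD (x x' : ι) : ∫ p, D x x' p ∂((ν.prod κ).prod ρ) =
      ∫ y, L x y * L x' y / m y ∂ν := by
    have := integral_prod_mul (μ := ν.prod κ) (ν := ρ)
      (fun q : 𝓨 × 𝓩 => (L x q.1 * L x' q.1 / m q.1) * K x q.2) (T x')
    rw [hT.integral_eq_one, mul_one,
      integral_prod_mul (fun y => L x y * L x' y / m y) (K x),
      hK.integral_eq_one, mul_one] at this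
    exact this
  have hpt (p : (𝓨 × 𝓩) × 𝓦) :
      c * ∑ x, (G x p + G0 x p - G1 x p - G2 x p) ≤
        (c * ∑ x, c * ∑ x', D x x' p) - mKT p := by
    obtain ⟨⟨y, z⟩, w⟩ := p
    have h0 : 0 < m y := hL.mixture_pos y
    have h1 : 0 < mK (y, z) := hLK.mixture_pos _
    have h2 : 0 < mT (y, w) := hLT.mixture_pos _
    have h3 : 0 < mKT ((y, z), w) := hLKT.mixture_pos _
    have hD : c * ∑ x, c * ∑ x', D x x' ((y, z), w) = mK (y, z) * mT (y, w) / m y := by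
      simp only [D, hmK, hmT, mixture, prodChannel, c, Finset.mul_sum, Finset.sum_mul,
        Finset.sum_div]
      rw [Finset.sum_comm]
      refine Finset.sum_congr rfl fun x _ => Finset.sum_congr rfl fun x' _ => ?_
      ring
    have hterm (x : ι) : G x ((y, z), w) + G0 x ((y, z), w) - G1 x ((y, z), w)
        - G2 x ((y, z), w) ≤ prodChannel (prodChannel L K) T x ((y, z), w) *
          (mK (y, z) * mT (y, w) / (m y * mKT ((y, z), w)) - 1) := by
      have a0 := hL.pos x y
      have a1 := hK.pos x z
      have a2 := hT.pos x w
      have hlog := Real.log_le_sub_one_of_pos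
        (show 0 < mK (y, z) * mT (y, w) / (m y * mKT ((y, z), w)) by positivity)
      rw [Real.log_div (by positivity) (by positivity), Real.log_mul h1.ne' h2.ne',
        Real.log_mul h0.ne' h3.ne'] at hlog
      have ha : 0 < L x y * K x z * T x w := by positivity
      refine le_trans (le_of_eq ?_) (mul_le_mul_of_nonneg_left hlog ha.le)
      simp only [G, G0, G1, G2, H2, e, prodRightComm, prodChannel,
        MeasurableEquiv.coe_mk, Equiv.coe_fn_mk]
      rw [Real.log_div (by positivity) h3.ne', Real.log_div (by positivity) h0.ne',
        Real.log_div (by positivity) h1.ne', Real.log_div (by positivity) h2.ne',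
        Real.log_mul (by positivity) a2.ne', Real.log_mul a0.ne' a1.ne',
        Real.log_mul a0.ne' a2.ne']
      ring
    refine (mul_le_mul_of_nonneg_left (Finset.sum_le_sum fun x _ => hterm x)
      (by positivity)).trans (le_of_eq ?_)
    rw [hD, ← Finset.sum_mul, ← mul_assoc]
    change mKT ((y, z), w) * _ = _
    field_simp
  have hint := integral_mono (μ := (ν.prod κ).prod ρ)
    ((integrable_finsetSum Finset.univ fun x _ =>
      (((iG x).add (iG0 x)).sub (iG1 x)).sub (iG2 x)).const_mul c)
    (((integrable_finsetSum Finset.univ fun x _ =>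
      ((integrable_finsetSum Finset.univ fun x' _ => iD x x').const_mul c)).const_mul c).sub
      hLKT.integrable_mixture) hpt
  have hR : ∫ p, (c * ∑ x, c * ∑ x', D x x' p) - mKT p ∂((ν.prod κ).prod ρ) = 0 := by
    rw [integral_sub ((integrable_finsetSum Finset.univ fun x _ =>
      ((integrable_finsetSum Finset.univ fun x' _ => iD x x').const_mul c)).const_mul c)
      hLKT.integrable_mixture, hLKT.integral_mixture, integral_const_mul,
      integral_finsetSum _ fun x _ =>
        ((integrable_finsetSum Finset.univ fun x' _ => iD x x').const_mul c)]
    simp_rw [integral_const_mul, integral_finsetSum Finset.univ fun x' _ => iD _ x', eD]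
    rw [hL.sum_sum_integral_mul_div_mixture, sub_self]
  have hLeft : ∫ p, c * ∑ x, (G x p + G0 x p - G1 x p - G2 x p) ∂((ν.prod κ).prod ρ) =
      channelInfo ((ν.prod κ).prod ρ) (prodChannel (prodChannel L K) T) + channelInfo ν L -
      channelInfo (ν.prod κ) (prodChannel L K) - channelInfo (ν.prod ρ) (prodChannel L T) := by
    have hi (x : ι) : Integrable (fun p => G x p + G0 x p - G1 x p - G2 x p)
        ((ν.prod κ).prod ρ) := (((iG x).add (iG0 x)).sub (iG1 x)).sub (iG2 x)
    rw [integral_const_mul, integral_finsetSum _ fun x _ => hi x]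
    have (x : ι) : ∫ p, (G x p + G0 x p - G1 x p - G2 x p) ∂((ν.prod κ).prod ρ) =
        ∫ p, G x p ∂((ν.prod κ).prod ρ) + ∫ p, G0 x p ∂((ν.prod κ).prod ρ)
          - ∫ p, G1 x p ∂((ν.prod κ).prod ρ) - ∫ p, G2 x p ∂((ν.prod κ).prod ρ) := by
      have h1 : Integrable (fun p => G x p + G0 x p) ((ν.prod κ).prod ρ) := (iG x).add (iG0 x)
      have h2 : Integrable (fun p => G x p + G0 x p - G1 x p) ((ν.prod κ).prod ρ) :=
        h1.sub (iG1 x)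
      rw [integral_sub h2 (iG2 x), integral_sub h1 (iG1 x), integral_add (iG x) (iG0 x)]
    simp_rw [this, eG0, eG1, eG2, Finset.sum_sub_distrib, Finset.sum_add_distrib]
    simp only [channelInfo, G, c]
    ring
  have := hLeft.symm.trans_le (hint.trans_eq hR)
  linarith

/-- A further observation whose law depends on the input strictly increases the information.
The gap is `I(X; Z | Y)`, bounded below by `log t ≥ 1 - 1 / t`, whose equality case `t = 1`
forces all conditional laws of `Z` to agree with their mixture. -/
theorem channelInfo_lt_prod (hL : IsDensityFamily ν L) (hK : IsDensityFamily κ K)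
    {x₀ x₁ : ι} (hne : ¬ K x₀ =ᵐ[κ] K x₁) :
    channelInfo ν L < channelInfo (ν.prod κ) (prodChannel L K) := by
  set m := mixture L
  set mK := mixture (prodChannel L K) with hmK
  have hLK := hL.prod hK
  let c : ℝ := (Fintype.card ι : ℝ)⁻¹
  have hc : 0 < c := by positivity
  let G (x : ι) (p : 𝓨 × 𝓩) : ℝ :=
    prodChannel L K x p * Real.log (prodChannel L K x p / mK p)
  let G0 (x : ι) (p : 𝓨 × 𝓩) : ℝ := (L x p.1 * Real.log (L x p.1 / m p.1)) * K x p.2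
  let D (x x' : ι) (p : 𝓨 × 𝓩) : ℝ := (L x p.1 * L x' p.1 / m p.1) * K x' p.2
  let U (x : ι) (p : 𝓨 × 𝓩) : ℝ :=
    G x p - G0 x p - (prodChannel L K x p - c * ∑ x', D x x' p)
  have iG (x : ι) : Integrable (G x) (ν.prod κ) := hLK.integrable_mul_log x
  have iG0 (x : ι) : Integrable (G0 x) (ν.prod κ) :=
    (hL.integrable_mul_log x).mul_prod (hK.integrable x)
  have iD (x x' : ι) : Integrable (D x x') (ν.prod κ) :=
    (hL.integrable_mul_div_mixture x x').mul_prod (hK.integrable x')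
  have iDs (x : ι) : Integrable (fun p => c * ∑ x', D x x' p) (ν.prod κ) :=
    (integrable_finsetSum Finset.univ fun x' _ => iD x x').const_mul c
  have iU (x : ι) : Integrable (U x) (ν.prod κ) :=
    ((iG x).sub (iG0 x)).sub ((hLK.integrable x).sub (iDs x))
  have eG0 (x : ι) : ∫ p, G0 x p ∂(ν.prod κ) = ∫ y, L x y * Real.log (L x y / m y) ∂ν := by
    have := integral_prod_mul (μ := ν) (ν := κ) (fun y => L x y * Real.log (L x y / m y)) (K x)
    rwa [hK.integral_eq_one, mul_one] at this
  have eD (x x' : ι) : ∫ p, D x x' p ∂(ν.prod κ) = ∫ y, L x y * L x' y / m y ∂ν := by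
    have := integral_prod_mul (μ := ν) (ν := κ) (fun y => L x y * L x' y / m y) (K x')
    rwa [hK.integral_eq_one, mul_one] at this
  have eU (x : ι) : ∫ p, U x p ∂(ν.prod κ) = ∫ p, G x p ∂(ν.prod κ) -
      ∫ y, L x y * Real.log (L x y / m y) ∂ν -
      (1 - c * ∑ x', ∫ y, L x y * L x' y / m y ∂ν) := by
    have h1 : Integrable (fun p => G x p - G0 x p) (ν.prod κ) := (iG x).sub (iG0 x)
    have h2 : Integrable (fun p => prodChannel L K x p - c * ∑ x', D x x' p) (ν.prod κ) :=
      (hLK.integrable x).sub (iDs x)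
    rw [integral_sub h1 h2,
      integral_sub (iG x) (iG0 x), integral_sub (hLK.integrable x) (iDs x), eG0,
      hLK.integral_eq_one, integral_const_mul, integral_finsetSum _ fun x' _ => iD x x']
    simp_rw [eD]
  have hsum : c * ∑ x, ∫ p, U x p ∂(ν.prod κ) =
      channelInfo (ν.prod κ) (prodChannel L K) - channelInfo ν L := by
    simp_rw [eU, Finset.sum_sub_distrib, mul_sub]
    rw [hL.sum_sum_integral_mul_div_mixture]
    have := inv_card_mul_sum_const (ι := ι) 1
    simp only [c, this]
    simp only [channelInfo, G, hmK]
    ring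
  have hUeq (x : ι) (y : 𝓨) (z : 𝓩) : U x (y, z) = L x y * K x z *
      (Real.log (K x z * m y / mK (y, z)) - (1 - (K x z * m y / mK (y, z))⁻¹)) := by
    have h0 : 0 < m y := hL.mixture_pos y
    have h1 : 0 < mK (y, z) := hLK.mixture_pos _
    have a0 := hL.pos x y
    have a1 := hK.pos x z
    have hD : c * ∑ x', D x x' (y, z) = L x y / m y * mK (y, z) := by
      simp only [D, hmK, mixture, prodChannel, c, Finset.mul_sum]
      refine Finset.sum_congr rfl fun x' _ => ?_
      ring
    simp only [U, hD]
    simp only [G, G0, prodChannel]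
    rw [Real.log_div (by positivity) h1.ne', Real.log_div a0.ne' h0.ne',
      Real.log_div (by positivity) h1.ne', Real.log_mul a0.ne' a1.ne', Real.log_mul a1.ne' h0.ne']
    field_simp
    ring
  have hU0 (x : ι) (p : 𝓨 × 𝓩) : 0 ≤ U x p := by
    obtain ⟨y, z⟩ := p
    rw [hUeq]
    have h0 : 0 < m y := hL.mixture_pos y
    have h1 : 0 < mK (y, z) := hLK.mixture_pos _
    have a0 := hL.pos x y
    have a1 := hK.pos x z
    exact mul_nonneg (by positivity)
      (sub_nonneg.2 (Real.one_sub_inv_le_log_of_pos (by positivity)))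
  have hIU (x : ι) : 0 ≤ ∫ p, U x p ∂(ν.prod κ) := integral_nonneg (hU0 x)
  by_contra hle
  have hzero : ∑ x, ∫ p, U x p ∂(ν.prod κ) = 0 := by
    refine le_antisymm ?_ (Finset.sum_nonneg fun x _ => hIU x)
    by_contra hlt
    have := mul_pos hc (not_le.1 hlt)
    rw [hsum] at this
    exact hle (sub_pos.1 this)
  have hae (x : ι) : ∀ᵐ p ∂(ν.prod κ), K x p.2 = mK p / m p.1 := by
    have h0 := (Finset.sum_eq_zero_iff_of_nonneg fun x _ => hIU x).1 hzero x (Finset.mem_univ x)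
    filter_upwards [(integral_eq_zero_iff_of_nonneg (hU0 x) (iU x)).1 h0] with p hp
    obtain ⟨y, z⟩ := p
    have h0 : 0 < m y := hL.mixture_pos y
    have h1 : 0 < mK (y, z) := hLK.mixture_pos _
    have a0 := hL.pos x y
    have a1 := hK.pos x z
    rw [hUeq] at hp
    have hp' : Real.log (K x z * m y / mK (y, z)) - (1 - (K x z * m y / mK (y, z))⁻¹) = 0 :=
      (mul_eq_zero.1 hp).resolve_left (by positivity)
    have ht : (K x z * m y / mK (y, z))⁻¹ = 1 := by
      by_contra hne1
      have := Real.log_lt_sub_one_of_pos (by positivity) hne1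
      rw [Real.log_inv] at this
      linarith
    rw [inv_eq_one, div_eq_one_iff_eq h1.ne'] at ht
    rw [eq_div_iff h0.ne', ht]
  have hν : ν ≠ 0 := by
    rintro rfl
    have := hL.integral_eq_one x₀
    simp at this
  have : (ae ν).NeBot := ae_neBot.2 hν
  have hall := Measure.ae_ae_of_ae_prod ((hae x₀).and (hae x₁))
  obtain ⟨y, hy⟩ := hall.exists
  exact hne (hy.mono fun z hz => hz.1.trans hz.2.symm)

end Inequalities

/-! ### Parallel channels with independent inputs -/

section ParallelChannels

variable {β ι 𝓨 : Type*} [Fintype β] [MeasurableSpace 𝓨] {ν : Measure 𝓨} [SigmaFinite ν]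
  {l : β → ι → 𝓨 → ℝ}

lemma IsDensityFamily.pi (hl : ∀ b, IsDensityFamily ν (l b)) :
    IsDensityFamily (Measure.pi fun _ : β => ν)
      (fun (x : β → ι) (y : β → 𝓨) => ∏ b, l b (x b) (y b)) where
  pos x y := Finset.prod_pos fun b _ => (hl b).pos (x b) (y b)
  measurable x := Finset.measurable_prod _ fun b _ =>
    ((hl b).measurable (x b)).comp (measurable_pi_apply b)
  integrable x := Integrable.fintype_prod_dep fun b => (hl b).integrable (x b)
  integral_eq_one x := by
    rw [integral_fintype_prod_eq_prod (fun b => l b (x b))]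
    exact Finset.prod_eq_one fun b _ => (hl b).integral_eq_one (x b)

variable [DecidableEq β] [Fintype ι]

lemma inv_card_mul_sum_prod (φ : β → ι → ℝ) :
    (Fintype.card (β → ι) : ℝ)⁻¹ * ∑ x : β → ι, ∏ b, φ b (x b) =
      ∏ b, ((Fintype.card ι : ℝ)⁻¹ * ∑ i, φ b i) := by
  rw [Finset.prod_mul_distrib, Fintype.prod_sum]
  simp

variable [Nonempty ι]

lemma inv_card_mul_sum_eval (b : β) (φ : ι → ℝ) :
    (Fintype.card (β → ι) : ℝ)⁻¹ * ∑ x : β → ι, φ (x b) =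
      (Fintype.card ι : ℝ)⁻¹ * ∑ i, φ i := by
  have h := inv_card_mul_sum_prod (fun b' i => if b' = b then φ i else (1 : ℝ))
  rw [Finset.prod_eq_single b] at h
  · simpa using h
  · intro b' _ hb'
    simp [hb']
  · simp

/-- Independent inputs sent over parallel channels with independent noises: the information is
the sum of the informations of the component channels. -/
theorem channelInfo_pi (hl : ∀ b, IsDensityFamily ν (l b)) :
    channelInfo (Measure.pi fun _ : β => ν)
      (fun (x : β → ι) (y : β → 𝓨) => ∏ b, l b (x b) (y b)) = ∑ b, channelInfo ν (l b) := by
  let φ (b : β) (i : ι) (y : 𝓨) : ℝ := l b i y * Real.log (l b i y / mixture (l b) y)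
  have hmix (y : β → 𝓨) : mixture (fun (x : β → ι) (y : β → 𝓨) => ∏ b, l b (x b) (y b)) y =
      ∏ b, mixture (l b) (y b) := inv_card_mul_sum_prod fun b i => l b i (y b)
  let F (x : β → ι) (b b' : β) (y : 𝓨) : ℝ :=
    if b' = b then φ b' (x b') y else l b' (x b') y
  have hF (x : β → ι) (y : β → 𝓨) : (∏ b, l b (x b) (y b)) * Real.log ((∏ b, l b (x b) (y b)) /
      ∏ b, mixture (l b) (y b)) = ∑ b, ∏ b', F x b b' (y b') := by
    rw [← Finset.prod_div_distrib, Real.log_prod fun b _ =>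
      (div_pos ((hl b).pos _ _) ((hl b).mixture_pos _)).ne', Finset.mul_sum]
    refine Finset.sum_congr rfl fun b _ => ?_
    have herase : ∏ b' ∈ Finset.univ.erase b, F x b b' (y b') =
        ∏ b' ∈ Finset.univ.erase b, l b' (x b') (y b') :=
      Finset.prod_congr rfl fun b' hb' => by
        simp only [F, Finset.ne_of_mem_erase hb', if_false]
    rw [← Finset.mul_prod_erase _ _ (Finset.mem_univ b),
      ← Finset.mul_prod_erase _ (fun b' => F x b b' (y b')) (Finset.mem_univ b), herase]
    simp only [F, φ, if_true]
    ring
  have hFi (x : β → ι) (b : β) :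
      Integrable (fun y : β → 𝓨 => ∏ b', F x b b' (y b')) (Measure.pi fun _ : β => ν) := by
    refine Integrable.fintype_prod_dep (f := F x b) fun b' => ?_
    by_cases h : b' = b
    · simpa only [F, h, if_true] using (hl b).integrable_mul_log (x b)
    · simpa only [F, h, if_false] using (hl b').integrable (x b')
  have hFe (x : β → ι) (b : β) :
      ∫ y : β → 𝓨, ∏ b', F x b b' (y b') ∂(Measure.pi fun _ : β => ν) =
        ∫ y, φ b (x b) y ∂ν := by
    rw [integral_fintype_prod_eq_prod (F x b), Finset.prod_eq_single b]
    · simp only [F, if_true]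
    · intro b' _ hb'
      simpa only [F, hb', if_false] using (hl b').integral_eq_one (x b')
    · simp
  unfold channelInfo
  simp_rw [hmix, hF, integral_finsetSum Finset.univ fun b _ => hFi _ b, hFe]
  rw [Finset.sum_comm, Finset.mul_sum]
  exact Finset.sum_congr rfl fun b _ => inv_card_mul_sum_eval b fun i => ∫ y, φ b i y ∂ν

end ParallelChannels

/-! ### Mutual information through densities -/

section MutualInformation

open scoped ENNReal

variable {ι 𝓧 𝓨 : Type*} [Fintype ι] [MeasurableSpace 𝓧] [MeasurableSingletonClass 𝓧]
  [MeasurableSpace 𝓨]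

lemma lintegral_uniformOn_range {e : ι → 𝓧} (he : Function.Injective e) (F : 𝓧 → ℝ≥0∞) :
    ∫⁻ x, F x ∂(uniformOn (Set.range e)) = (Fintype.card ι : ℝ≥0∞)⁻¹ * ∑ i, F (e i) := by
  classical
  have hr : Set.range e = ((Finset.univ.map ⟨e, he⟩ : Finset 𝓧) : Set 𝓧) := by simp
  rw [uniformOn, ProbabilityTheory.cond, lintegral_smul_measure, hr, lintegral_finset,
    Measure.count_apply_finset]
  simp

/-- For a uniformly distributed input, the Kullback-Leibler divergence of the joint law of input
and output from the product of its marginals is given by the explicit formula `channelInfo`. The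
joint law is described through its action on nonnegative functions. -/
theorem toReal_klDiv_eq_channelInfo [Nonempty ι] {e : ι → 𝓧} (he : Function.Injective e)
    {κ : Measure 𝓨} [SFinite κ] {K : 𝓧 → 𝓨 → ℝ} (hK : Measurable (Function.uncurry K))
    (hL : IsDensityFamily κ (fun i => K (e i))) (μ : Measure (𝓧 × 𝓨))
    (hμ : ∀ F : 𝓧 × 𝓨 → ℝ≥0∞, Measurable F → ∫⁻ p, F p ∂μ =
      (Fintype.card ι : ℝ≥0∞)⁻¹ * ∑ i, ∫⁻ y, F (e i, y) * ENNReal.ofReal (K (e i) y) ∂κ) :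
    (InformationTheory.klDiv μ (μ.fst.prod μ.snd)).toReal =
      channelInfo κ (fun i => K (e i)) := by
  set m := mixture (fun i => K (e i)) with hm
  have hmm : Measurable m := hL.measurable_mixture
  have hcard : (Fintype.card ι : ℝ≥0∞) ≠ 0 := by simp
  have hcard' : (Fintype.card ι : ℝ≥0∞) ≠ ∞ := by simp
  have hone (i : ι) : ∫⁻ y, ENNReal.ofReal (K (e i) y) ∂κ = 1 := by
    rw [← ofReal_integral_eq_lintegral_ofReal (hL.integrable i)
      (Filter.Eventually.of_forall fun y => (hL.pos i y).le), hL.integral_eq_one,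
      ENNReal.ofReal_one]
  have hKm (i : ι) : Measurable fun y => ENNReal.ofReal (K (e i) y) :=
    (hL.measurable i).ennreal_ofReal
  have hmix (y : 𝓨) : ENNReal.ofReal (m y) =
      (Fintype.card ι : ℝ≥0∞)⁻¹ * ∑ i, ENNReal.ofReal (K (e i) y) := by
    rw [hm, mixture, ENNReal.ofReal_mul (by positivity), ENNReal.ofReal_inv_of_pos (by positivity),
      ENNReal.ofReal_natCast, ENNReal.ofReal_sum_of_nonneg fun i _ => (hL.pos i y).le]
  have hfst : μ.fst = uniformOn (Set.range e) := by
    ext s hs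
    rw [Measure.fst_apply hs, ← lintegral_indicator_one hs,
      ← lintegral_indicator_one (measurable_fst hs), lintegral_uniformOn_range he,
      hμ _ (measurable_one.indicator (measurable_fst hs))]
    congr 1
    refine Finset.sum_congr rfl fun i _ => ?_
    have (y : 𝓨) : (Prod.fst ⁻¹' s).indicator (1 : 𝓧 × 𝓨 → ℝ≥0∞) (e i, y) =
        s.indicator 1 (e i) := rfl
    simp_rw [this, lintegral_const_mul _ (hKm i), hone, mul_one]
  have hsnd : μ.snd = κ.withDensity fun y => ENNReal.ofReal (m y) := by
    ext s hs
    rw [Measure.snd_apply hs, withDensity_apply _ hs, ← lintegral_indicator hs,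
      ← lintegral_indicator_one (measurable_snd hs),
      hμ _ (measurable_one.indicator (measurable_snd hs)),
      ← lintegral_finsetSum _ fun i _ => ?_, ← lintegral_const_mul _ ?_]
    · refine lintegral_congr fun y => ?_
      by_cases hy : y ∈ s
      · simp [hy, hmix]
      · simp [hy]
    · exact Finset.measurable_sum _ fun i _ =>
        ((measurable_one.indicator (measurable_snd hs)).comp measurable_prodMk_left).mul (hKm i)
    · exact ((measurable_one.indicator (measurable_snd hs)).comp measurable_prodMk_left).mul
        (hKm i)
  have hν (F : 𝓧 × 𝓨 → ℝ≥0∞) (hF : Measurable F) : ∫⁻ p, F p ∂(μ.fst.prod μ.snd) =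
      (Fintype.card ι : ℝ≥0∞)⁻¹ * ∑ i, ∫⁻ y, F (e i, y) * ENNReal.ofReal (m y) ∂κ := by
    have hsf : SFinite μ.snd := by rw [hsnd]; infer_instance
    rw [lintegral_prod _ hF.aemeasurable, hfst, lintegral_uniformOn_range he, hsnd]
    congr 1
    refine Finset.sum_congr rfl fun i _ => ?_
    rw [lintegral_withDensity_eq_lintegral_mul (g := fun y => F (e i, y)) _ hmm.ennreal_ofReal
      (hF.comp measurable_prodMk_left)]
    exact lintegral_congr fun y => mul_comm _ _
  have hμprob : IsProbabilityMeasure μ := ⟨by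
    have := hμ 1 measurable_one
    simp only [Pi.one_apply, one_mul, hone, Finset.sum_const, Finset.card_univ, nsmul_eq_mul,
      mul_one, lintegral_one] at this
    rw [this, ENNReal.inv_mul_cancel hcard hcard']⟩
  have hr : Measurable fun p : 𝓧 × 𝓨 => K p.1 p.2 / m p.2 :=
    hK.div (hmm.comp measurable_snd)
  have hμν : μ = (μ.fst.prod μ.snd).withDensity
      fun p => ENNReal.ofReal (K p.1 p.2 / m p.2) := by
    ext s hs
    rw [withDensity_apply _ hs, ← lintegral_indicator hs,
      hν _ (hr.ennreal_ofReal.indicator hs), ← lintegral_indicator_one hs,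
      hμ _ (measurable_one.indicator hs)]
    congr 1
    refine Finset.sum_congr rfl fun i _ => lintegral_congr fun y => ?_
    by_cases hy : (e i, y) ∈ s
    · have hpos : 0 < m y := hL.mixture_pos y
      simp only [Set.indicator_of_mem hy, Pi.one_apply, one_mul]
      rw [← ENNReal.ofReal_mul (div_pos (hL.pos i y) hpos).le, div_mul_cancel₀ _ hpos.ne']
    · simp [Set.indicator_of_notMem hy]
  have hac : μ ≪ μ.fst.prod μ.snd := by
    nth_rewrite 1 [hμν]
    exact withDensity_absolutelyContinuous _ _
  have hllr : llr μ (μ.fst.prod μ.snd) =ᵐ[μ] fun p => Real.log (K p.1 p.2 / m p.2) := by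
    have h1 := Measure.rnDeriv_withDensity (μ.fst.prod μ.snd) hr.ennreal_ofReal
    rw [← hμν] at h1
    have h2 : ∀ᵐ p ∂μ, 0 ≤ K p.1 p.2 / m p.2 := by
      have hs : MeasurableSet {p : 𝓧 × 𝓨 | ¬ 0 ≤ K p.1 p.2 / m p.2} :=
        (measurableSet_le measurable_const hr).compl
      rw [ae_iff, ← lintegral_indicator_one hs, hμ _ (measurable_one.indicator hs)]
      have (i : ι) (y : 𝓨) : {p : 𝓧 × 𝓨 | ¬ 0 ≤ K p.1 p.2 / m p.2}.indicator
          (1 : 𝓧 × 𝓨 → ℝ≥0∞) (e i, y) = 0 := by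
        refine Set.indicator_of_notMem ?_ _
        simpa using (div_pos (hL.pos i y) (hL.mixture_pos y)).le
      simp only [this, zero_mul, lintegral_zero, Finset.sum_const_zero, mul_zero]
    filter_upwards [hac.ae_le h1, h2] with p hp hp0
    rw [llr, hp, ENNReal.toReal_ofReal hp0]
  rw [InformationTheory.toReal_klDiv_of_measure_eq hac (by simp), integral_congr_ae hllr]
  -- The joint law is the average of the images of the conditional output laws.
  have hsum : μ = ∑ i, (Fintype.card ι : ℝ≥0∞)⁻¹ •
      (κ.withDensity fun y => ENNReal.ofReal (K (e i) y)).map (Prod.mk (e i)) := by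
    ext s hs
    rw [← lintegral_indicator_one hs, hμ _ (measurable_one.indicator hs), Finset.mul_sum,
      Measure.finsetSum_apply]
    refine Finset.sum_congr rfl fun i _ => ?_
    rw [Measure.smul_apply, smul_eq_mul, Measure.map_apply measurable_prodMk_left hs,
      withDensity_apply _ (measurable_prodMk_left hs),
      ← lintegral_indicator (measurable_prodMk_left hs)]
    congr 1
    refine lintegral_congr fun y => ?_
    by_cases hy : (e i, y) ∈ s
    · simp [hy]
    · simp [hy]
  have hmeas : Measurable fun p : 𝓧 × 𝓨 => Real.log (K p.1 p.2 / m p.2) := hr.log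
  have hint (i : ι) : Integrable (fun p : 𝓧 × 𝓨 => Real.log (K p.1 p.2 / m p.2))
      ((κ.withDensity fun y => ENNReal.ofReal (K (e i) y)).map (Prod.mk (e i))) := by
    rw [integrable_map_measure hmeas.aestronglyMeasurable measurable_prodMk_left.aemeasurable,
      integrable_withDensity_iff_integrable_smul₀' (hKm i).aemeasurable
        (Filter.Eventually.of_forall fun y => ENNReal.ofReal_lt_top)]
    refine (hL.integrable_mul_log i).congr (Filter.Eventually.of_forall fun y => ?_)
    simp only [ENNReal.toReal_ofReal (hL.pos i y).le, smul_eq_mul]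
    rfl
  nth_rewrite 1 [hsum]
  rw [integral_finsetSum_measure fun i _ => (hint i).smul_measure (by simp), channelInfo,
    Finset.mul_sum]
  refine Finset.sum_congr rfl fun i _ => ?_
  rw [integral_smul_measure, integral_map measurable_prodMk_left.aemeasurable
    hmeas.aestronglyMeasurable, integral_withDensity_eq_integral_toReal_smul (hKm i)
    (Filter.Eventually.of_forall fun y => ENNReal.ofReal_lt_top)]
  simp only [ENNReal.toReal_inv, ENNReal.toReal_natCast, smul_eq_mul]
  congr 1
  refine integral_congr_ae (Filter.Eventually.of_forall fun y => ?_)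
  simp only [ENNReal.toReal_ofReal (hL.pos i y).le]
  rfl

end MutualInformation

/-! ### Complex Gaussian noise and maximal ratio combining -/

section Gaussian

/-- The probability density of the noise law `complexNoise γ` on the complex plane. -/
noncomputable def noiseDensity (γ : ℝ) (z : ℂ) : ℝ := γ / Real.pi * Real.exp (-γ * ‖z‖ ^ 2)

/-- The transition densities of the channel `Y = a X + W`, where the input symbol labelled by `i`
is the complex number `c i` and `W` has the law `complexNoise γ`. -/
noncomputable def fadingChannel {ι : Type*} (γ : ℝ) (c : ι → ℂ) (a : ℝ) (i : ι) (z : ℂ) : ℝ :=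
  noiseDensity γ (z - a * c i)

variable {γ : ℝ}

lemma noiseDensity_pos (hγ : 0 < γ) (z : ℂ) : 0 < noiseDensity γ z :=
  mul_pos (div_pos hγ Real.pi_pos) (Real.exp_pos _)

@[fun_prop]
lemma continuous_noiseDensity (γ : ℝ) : Continuous (noiseDensity γ) := by
  unfold noiseDensity
  fun_prop

lemma complexNoise_eq_withDensity (hγ : 0 < γ) :
    complexNoise γ = volume.withDensity fun z => ENNReal.ofReal (noiseDensity γ z) := by
  have hv : Real.toNNReal (1 / (2 * γ)) ≠ 0 := by
    rw [ne_eq, Real.toNNReal_eq_zero, not_le]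
    positivity
  have hpdf (p : ℝ × ℝ) : gaussianPDF 0 (Real.toNNReal (1 / (2 * γ))) p.1 *
      gaussianPDF 0 (Real.toNNReal (1 / (2 * γ))) p.2 =
        ENNReal.ofReal (noiseDensity γ (Complex.measurableEquivRealProd.symm p)) := by
    have h1 : 2 * Real.pi * (1 / (2 * γ)) = Real.pi / γ := by field_simp
    have h2 : (2 * (1 / (2 * γ))) = γ⁻¹ := by field_simp
    have h3 : (√(Real.pi / γ))⁻¹ * (√(Real.pi / γ))⁻¹ = γ / Real.pi := by
      rw [← mul_inv, Real.mul_self_sqrt (by positivity), inv_div]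
    have h4 : ‖Complex.measurableEquivRealProd.symm p‖ ^ 2 = p.1 ^ 2 + p.2 ^ 2 := by
      rw [Complex.sq_norm, Complex.normSq_apply]
      simp [Complex.measurableEquivRealProd_symm_apply, sq]
    rw [gaussianPDF, gaussianPDF, ← ENNReal.ofReal_mul (gaussianPDFReal_nonneg _ _ _)]
    congr 1
    simp only [gaussianPDFReal, noiseDensity, Real.coe_toNNReal _ (by positivity :
      (0 : ℝ) ≤ 1 / (2 * γ)), h1, h2, h4, sub_zero]
    rw [mul_mul_mul_comm, h3, ← Real.exp_add]
    congr 2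
    field_simp
    ring
  have hmp := Complex.volume_preserving_equiv_real_prod.symm
  have hfun : (fun p : ℝ × ℝ => (⟨p.1, p.2⟩ : ℂ)) = Complex.measurableEquivRealProd.symm := by
    funext p
    rfl
  rw [complexNoise, gaussianReal_of_var_ne_zero _ hv, prod_withDensity (by fun_prop) (by fun_prop),
    hfun]
  simp_rw [hpdf]
  ext s hs
  rw [Measure.map_apply (MeasurableEquiv.measurable _) hs,
    withDensity_apply _ (MeasurableEquiv.measurable _ hs), withDensity_apply _ hs]
  exact hmp.setLIntegral_comp_preimage_emb (MeasurableEquiv.measurableEmbedding _)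
    (fun z => ENNReal.ofReal (noiseDensity γ z)) s

instance isProbabilityMeasure_complexNoise (γ : ℝ) : IsProbabilityMeasure (complexNoise γ) :=
  Measure.isProbabilityMeasure_map
    (Complex.measurableEquivRealProd.symm.measurable).aemeasurable

lemma integrable_noiseDensity (hγ : 0 < γ) : Integrable (noiseDensity γ) := by
  have h := measure_univ (μ := complexNoise γ)
  rw [complexNoise_eq_withDensity hγ, withDensity_apply _ MeasurableSet.univ,
    Measure.restrict_univ] at h
  exact (lintegral_ofReal_ne_top_iff_integrable
    (continuous_noiseDensity γ).measurable.aestronglyMeasurable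
    (Filter.Eventually.of_forall fun z => (noiseDensity_pos hγ z).le)).1 (by rw [h]; simp)

lemma integral_noiseDensity (hγ : 0 < γ) : ∫ z, noiseDensity γ z = 1 := by
  have h := measure_univ (μ := complexNoise γ)
  rw [complexNoise_eq_withDensity hγ, withDensity_apply _ MeasurableSet.univ,
    Measure.restrict_univ] at h
  rw [integral_eq_lintegral_of_nonneg_ae
    (Filter.Eventually.of_forall fun z => (noiseDensity_pos hγ z).le)
    (continuous_noiseDensity γ).measurable.aestronglyMeasurable, h, ENNReal.toReal_one]

lemma isDensityFamily_fadingChannel {ι : Type*} (hγ : 0 < γ) (c : ι → ℂ) (a : ℝ) :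
    IsDensityFamily volume (fadingChannel γ c a) where
  pos i z := noiseDensity_pos hγ _
  measurable i := by
    unfold fadingChannel
    exact Continuous.measurable (by fun_prop)
  integrable i := (integrable_noiseDensity hγ).comp_sub_right _
  integral_eq_one i := by
    unfold fadingChannel
    rw [integral_sub_right_eq_self (noiseDensity γ) (a * c i : ℂ), integral_noiseDensity hγ]

/-- Symbols that are distinct after scaling give output densities that are not almost everywhere
equal: at the centre of one of them, the other is strictly below its peak value. -/
lemma not_fadingChannel_ae_eq {ι : Type*} (hγ : 0 < γ) {c : ι → ℂ} {a : ℝ} (ha : a ≠ 0) {i j : ι}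
    (hij : c i ≠ c j) : ¬ fadingChannel γ c a i =ᵐ[volume] fadingChannel γ c a j := by
  intro h
  have hc (i : ι) : Continuous (fadingChannel γ c a i) := by
    unfold fadingChannel
    fun_prop
  have h0 := congrFun ((Continuous.ae_eq_iff_eq volume (hc i) (hc j)).1 h) (a * c i)
  have hpi : γ / Real.pi ≠ 0 := (div_pos hγ Real.pi_pos).ne'
  have h1 : (a : ℂ) * c i - a * c j ≠ 0 := by
    rw [← mul_sub]
    exact mul_ne_zero (by exact_mod_cast ha) (sub_ne_zero.2 hij)
  simp only [fadingChannel, noiseDensity] at h0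
  have h2 := Real.exp_injective (mul_left_cancel₀ hpi h0)
  rw [sub_self, norm_zero] at h2
  have h3 : 0 < γ * ‖(a : ℂ) * c i - a * c j‖ ^ 2 := by positivity
  linarith

/-- The rotation of `ℂ × ℂ` with cosine `k` and sine `l`, acting on the two complex coordinates. -/
def pairRotation (k l : ℝ) (h : k ^ 2 + l ^ 2 = 1) : ℂ × ℂ ≃ᵐ ℂ × ℂ where
  toFun p := (k * p.1 + l * p.2, k * p.2 - l * p.1)
  invFun p := (k * p.1 - l * p.2, k * p.2 + l * p.1)
  left_inv p := by
    have h' : (k : ℂ) ^ 2 + (l : ℂ) ^ 2 = 1 := by exact_mod_cast h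
    ext1
    · linear_combination p.1 * h'
    · linear_combination p.2 * h'
  right_inv p := by
    have h' : (k : ℂ) ^ 2 + (l : ℂ) ^ 2 = 1 := by exact_mod_cast h
    ext1
    · linear_combination p.1 * h'
    · linear_combination p.2 * h'
  measurable_toFun := by simp only [Equiv.coe_fn_mk]; fun_prop
  measurable_invFun := by simp only [Equiv.coe_fn_symm_mk]; fun_prop

lemma measurePreserving_pairRotation (k l : ℝ) (h : k ^ 2 + l ^ 2 = 1) :
    MeasurePreserving (pairRotation k l h) (volume.prod volume) (volume.prod volume) := by
  -- A rotation is an isometry for the Euclidean norm of `ℂ × ℂ`.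
  let f : WithLp 2 (ℂ × ℂ) →ₗᵢ[ℝ] WithLp 2 (ℂ × ℂ) :=
    { toFun := fun p => WithLp.toLp 2 (pairRotation k l h (WithLp.ofLp p))
      map_add' := fun p q => by
        apply (WithLp.equiv 2 (ℂ × ℂ)).injective
        ext1 <;> simp [pairRotation] <;> ring
      map_smul' := fun r p => by
        apply (WithLp.equiv 2 (ℂ × ℂ)).injective
        ext1 <;> simp [pairRotation] <;> ring
      norm_map' := fun p => by
        rw [← sq_eq_sq₀ (norm_nonneg _) (norm_nonneg _)]
        simp only [LinearMap.coe_mk, AddHom.coe_mk, WithLp.prod_norm_sq_eq_of_L2]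
        simp only [pairRotation, MeasurableEquiv.coe_mk, Equiv.coe_fn_mk, Complex.sq_norm,
          Complex.normSq_apply]
        simp
        linear_combination (p.fst.re ^ 2 + p.fst.im ^ 2 + p.snd.re ^ 2 + p.snd.im ^ 2) * h }
  let F : WithLp 2 (ℂ × ℂ) ≃ₗᵢ[ℝ] WithLp 2 (ℂ × ℂ) := LinearIsometryEquiv.ofSurjective f fun q =>
    ⟨WithLp.toLp 2 ((pairRotation k l h).symm (WithLp.ofLp q)), by
      simp [f]⟩
  exact (WithLp.volume_preserving_ofLp ℂ ℂ).comp
    (F.measurePreserving.comp (WithLp.volume_preserving_toLp ℂ ℂ))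

lemma noiseDensity_mul_noiseDensity (γ : ℝ) (z w : ℂ) : noiseDensity γ z * noiseDensity γ w =
    (γ / Real.pi) ^ 2 * Real.exp (-γ * (‖z‖ ^ 2 + ‖w‖ ^ 2)) := by
  rw [noiseDensity, noiseDensity, mul_mul_mul_comm, ← Real.exp_add]
  ring_nf

/-- Rotating the pair of observations `k r X + W`, `l r X + W'` concentrates the signal in the
first coordinate: the pair becomes `r X + W`, `W'`. -/
lemma prodChannel_fadingChannel_eq {ι : Type*} (c : ι → ℂ) {k l r : ℝ} (h : k ^ 2 + l ^ 2 = 1)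
    (i : ι) (p : ℂ × ℂ) :
    prodChannel (fadingChannel γ c (k * r)) (fadingChannel γ c (l * r)) i p =
      fadingChannel γ c r i (pairRotation k l h p).1 *
        noiseDensity γ (pairRotation k l h p).2 := by
  simp only [prodChannel, fadingChannel, noiseDensity_mul_noiseDensity]
  congr 3
  simp only [pairRotation, MeasurableEquiv.coe_mk, Equiv.coe_fn_mk, Complex.sq_norm,
    Complex.normSq_apply]
  simp
  linear_combination -(p.1.re ^ 2 + p.1.im ^ 2 + p.2.re ^ 2 + p.2.im ^ 2
    - r ^ 2 * ((c i).re ^ 2 + (c i).im ^ 2)) * h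

/-- Maximal ratio combining: two observations of the same symbol with gains `k r` and `l r` carry
the same information as a single observation with gain `r`. -/
theorem channelInfo_prod_fadingChannel {ι : Type*} [Fintype ι] (hγ : 0 < γ) (c : ι → ℂ)
    {k l : ℝ} (h : k ^ 2 + l ^ 2 = 1) (r : ℝ) :
    channelInfo (volume.prod volume)
        (prodChannel (fadingChannel γ c (k * r)) (fadingChannel γ c (l * r))) =
      channelInfo volume (fadingChannel γ c r) := by
  rw [← channelInfo_mul_common (κ := volume) (fadingChannel γ c r) (noiseDensity_pos hγ)
    (integral_noiseDensity hγ)]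
  refine Eq.trans ?_ (channelInfo_comp_equiv (measurePreserving_pairRotation k l h) _)
  congr 1
  funext i p
  exact prodChannel_fadingChannel_eq c h i p

/-- Maximal ratio combining in the presence of a further observation. -/
theorem channelInfo_prod_prod_fadingChannel {ι 𝓩 : Type*} [Fintype ι] [MeasurableSpace 𝓩]
    (hγ : 0 < γ) (c : ι → ℂ) {k l : ℝ} (h : k ^ 2 + l ^ 2 = 1) (r : ℝ) (ν : Measure 𝓩)
    [SFinite ν] (T : ι → 𝓩 → ℝ) :
    channelInfo ((volume.prod volume).prod ν) (prodChannel
        (prodChannel (fadingChannel γ c (k * r)) (fadingChannel γ c (l * r))) T) =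
      channelInfo (volume.prod ν) (prodChannel (fadingChannel γ c r) T) := by
  have he := measurePreserving_prodRightComm (volume : Measure ℂ) (volume : Measure ℂ) ν
  have hrot : MeasurePreserving ((pairRotation k l h).prodCongr (MeasurableEquiv.refl 𝓩))
      ((volume.prod volume).prod ν) ((volume.prod volume).prod ν) :=
    (measurePreserving_pairRotation k l h).prod (MeasurePreserving.id ν)
  rw [← channelInfo_mul_common (κ := volume) (prodChannel (fadingChannel γ c r) T)
    (noiseDensity_pos hγ) (integral_noiseDensity hγ)]
  refine Eq.trans ?_ (channelInfo_comp_equiv (hrot.trans he) _)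
  congr 1
  funext i p
  have := prodChannel_fadingChannel_eq (γ := γ) c (r := r) h i p.1
  change prodChannel _ _ i p.1 * T i p.2 = (fadingChannel γ c r i (pairRotation k l h p.1).1 *
    T i p.2) * noiseDensity γ (pairRotation k l h p.1).2
  rw [this]
  ring

/-- The mutual information, in nats, of a single block as a function of the squared gain. Only
nonnegative arguments are meaningful. -/
noncomputable def blockInfo {ι : Type*} [Fintype ι] (γ : ℝ) (c : ι → ℂ) (s : ℝ) : ℝ :=
  channelInfo volume (fadingChannel γ c √s)

lemma blockInfo_zero {ι : Type*} [Fintype ι] [Nonempty ι] (hγ : 0 < γ) (c : ι → ℂ) :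
    blockInfo γ c 0 = 0 := by
  have : fadingChannel γ c √0 = fun _ : ι => noiseDensity γ := by
    funext i z
    simp [fadingChannel]
  rw [blockInfo, this, channelInfo_eq_zero_of_common (noiseDensity_pos hγ)]

lemma blockInfo_eq_zero_of_subsingleton {ι : Type*} [Fintype ι] [Nonempty ι] [Subsingleton ι]
    (hγ : 0 < γ) (c : ι → ℂ) (s : ℝ) : blockInfo γ c s = 0 := by
  have i₀ : ι := Classical.arbitrary ι
  have : fadingChannel γ c √s = fun _ : ι => fadingChannel γ c √s i₀ := by
    funext i
    rw [Subsingleton.elim i i₀]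
  rw [blockInfo, this]
  exact channelInfo_eq_zero_of_common fun z => noiseDensity_pos hγ _

lemma exists_sqrt_eq_mul_sqrt_add {s u : ℝ} (hs : 0 ≤ s) (hu : 0 ≤ u) :
    ∃ k l : ℝ, k ^ 2 + l ^ 2 = 1 ∧ √s = k * √(s + u) ∧ √u = l * √(s + u) := by
  rcases (add_nonneg hs hu).eq_or_lt with h | h
  · have hs0 : s = 0 := by linarith
    have hu0 : u = 0 := by linarith
    exact ⟨1, 0, by norm_num, by simp [hs0, hu0], by simp [hu0]⟩
  · have h' : √(s + u) ≠ 0 := (Real.sqrt_pos.2 h).ne'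
    refine ⟨√s / √(s + u), √u / √(s + u), ?_, (div_mul_cancel₀ _ h').symm,
      (div_mul_cancel₀ _ h').symm⟩
    rw [div_pow, div_pow, Real.sq_sqrt hs, Real.sq_sqrt hu, Real.sq_sqrt h.le, ← add_div,
      div_self h.ne']

/-- Diminishing returns: a given increase of the squared gain is worth less at a larger gain. -/
theorem blockInfo_add_le {ι : Type*} [Fintype ι] [Nonempty ι] (hγ : 0 < γ) (c : ι → ℂ)
    {s u v : ℝ} (hs : 0 ≤ s) (hu : 0 ≤ u) (hv : 0 ≤ v) :
    blockInfo γ c (s + u + v) + blockInfo γ c s ≤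
      blockInfo γ c (s + u) + blockInfo γ c (s + v) := by
  have hd := isDensityFamily_fadingChannel hγ c
  have key := channelInfo_prod_add_le (hd √s) (hd √u) (hd √v)
  have hpair {x y : ℝ} (hx : 0 ≤ x) (hy : 0 ≤ y) : channelInfo (volume.prod volume)
      (prodChannel (fadingChannel γ c √x) (fadingChannel γ c √y)) = blockInfo γ c (x + y) := by
    obtain ⟨k, l, h, hk, hl⟩ := exists_sqrt_eq_mul_sqrt_add hx hy
    rw [hk, hl, channelInfo_prod_fadingChannel hγ c h, blockInfo]
  have htriple : channelInfo ((volume.prod volume).prod volume) (prodChannel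
      (prodChannel (fadingChannel γ c √s) (fadingChannel γ c √u)) (fadingChannel γ c √v)) =
      blockInfo γ c (s + u + v) := by
    obtain ⟨k, l, h, hk, hl⟩ := exists_sqrt_eq_mul_sqrt_add hs hu
    rw [hk, hl, channelInfo_prod_prod_fadingChannel hγ c h, hpair (add_nonneg hs hu) hv]
  rw [htriple, hpair hs hu, hpair hs hv] at key
  exact key

theorem strictMonoOn_blockInfo {ι : Type*} [Fintype ι] [Nontrivial ι] (hγ : 0 < γ) {c : ι → ℂ}
    (hc : Function.Injective c) : StrictMonoOn (blockInfo γ c) (Set.Ici 0) := by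
  intro s hs t _ hst
  obtain ⟨i, j, hij⟩ := exists_pair_ne ι
  have hu : 0 < t - s := sub_pos.2 hst
  have hd := isDensityFamily_fadingChannel hγ c
  have key := channelInfo_lt_prod (hd √s) (hd √(t - s))
    (not_fadingChannel_ae_eq hγ (Real.sqrt_pos.2 hu).ne' (hc.ne hij))
  obtain ⟨k, l, h, hk, hl⟩ := exists_sqrt_eq_mul_sqrt_add hs hu.le
  rw [hl] at key
  nth_rewrite 2 [hk] at key
  rw [channelInfo_prod_fadingChannel hγ c h, add_sub_cancel] at key
  exact key

end Gaussian

/-! ### The block fading channel as a product of parallel channels -/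

section BlockFadingChannel

/-- A product of identical laws with density `q` has the product density. -/
lemma pi_withDensity {β 𝓨 : Type*} [Fintype β] [MeasurableSpace 𝓨] {ν : Measure 𝓨} [SigmaFinite ν]
    {q : 𝓨 → ℝ} (hq : ∀ y, 0 ≤ q y) (hqi : Integrable q ν) :
    Measure.pi (fun _ : β => ν.withDensity fun y => ENNReal.ofReal (q y)) =
      (Measure.pi fun _ : β => ν).withDensity fun y => ENNReal.ofReal (∏ b, q (y b)) := by
  have : SigmaFinite (ν.withDensity fun y => ENNReal.ofReal (q y)) :=
    SigmaFinite.withDensity_ofReal _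
  refine Measure.pi_eq fun s hs => ?_
  have hi : Integrable (fun y : β → 𝓨 => ∏ b, q (y b)) (Measure.pi fun _ : β => ν) :=
    Integrable.fintype_prod_dep fun _ => hqi
  rw [withDensity_apply _ (MeasurableSet.univ_pi hs),
    ← ofReal_integral_eq_lintegral_ofReal hi.integrableOn
    (Filter.Eventually.of_forall fun y => Finset.prod_nonneg fun b _ => hq _),
    Measure.restrict_pi_pi, integral_fintype_prod_eq_prod (fun _ => q),
    ENNReal.ofReal_prod_of_nonneg fun b _ => integral_nonneg hq]
  refine Finset.prod_congr rfl fun b _ => ?_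
  rw [withDensity_apply _ (hs b), ofReal_integral_eq_lintegral_ofReal hqi.integrableOn
    (Filter.Eventually.of_forall hq)]

/-- Because the alphabet is a Cartesian product, the information of the block fading channel is
the average over the blocks of the information of a single block. -/
theorem instMutualInfo_eq {B : ℕ} {ι : Type*} [Fintype ι] [Nonempty ι] {γ : ℝ} (hγ : 0 < γ)
    {c : ι → ℂ} (hc : Function.Injective c) {α : Fin B → ℝ} (hα : α ∈ fadingSpace B) :
    instMutualInfo (Set.range fun (x : Fin B → ι) b => c (x b)) γ α =
      (∑ b, blockInfo γ c (α b ^ 2)) / (B * Real.log 2) := by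
  let e : (Fin B → ι) → Fin B → ℂ := fun x b => c (x b)
  have he : Function.Injective e := fun x y hxy => funext fun b => hc (congrFun hxy b)
  let K : (Fin B → ℂ) → (Fin B → ℂ) → ℝ := fun x y => ∏ b, noiseDensity γ (y b - α b * x b)
  have hK : Measurable (Function.uncurry K) := by
    refine Continuous.measurable ?_
    unfold K Function.uncurry
    fun_prop
  have hl (b : Fin B) := isDensityFamily_fadingChannel hγ c (α b)
  have hL : IsDensityFamily (Measure.pi fun _ : Fin B => (volume : Measure ℂ))
    (fun i => K (e i)) := IsDensityFamily.pi hl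
  have hpi : Measure.pi (fun _ : Fin B => complexNoise γ) =
      (Measure.pi fun _ : Fin B => (volume : Measure ℂ)).withDensity
        fun y => ENNReal.ofReal (∏ b, noiseDensity γ (y b)) := by
    rw [complexNoise_eq_withDensity hγ, pi_withDensity (fun z => (noiseDensity_pos hγ z).le)
      (integrable_noiseDensity hγ)]
  have key := toReal_klDiv_eq_channelInfo he hK hL (channelLaw (Set.range e) γ α)
    fun F hF => by
      have hm : Measurable fun p : (Fin B → ℂ) × (Fin B → ℂ) =>
          (p.1, fun b => (α b : ℂ) * p.1 b + p.2 b) := by fun_prop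
      rw [channelLaw, lintegral_map hF hm, lintegral_prod
        (fun p : (Fin B → ℂ) × (Fin B → ℂ) => F (p.1, fun b => (α b : ℂ) * p.1 b + p.2 b))
        (hF.comp hm).aemeasurable,
        lintegral_uniformOn_range he]
      congr 1
      refine Finset.sum_congr rfl fun i _ => ?_
      have hn : Measurable fun y : Fin B → ℂ => ENNReal.ofReal (∏ b, noiseDensity γ (y b)) :=
        (Continuous.measurable (by fun_prop)).ennreal_ofReal
      rw [hpi, lintegral_withDensity_eq_lintegral_mul
        (g := fun y => F (e i, fun b => (α b : ℂ) * e i b + y b)) _ hn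
        ((hF.comp hm).comp measurable_prodMk_left)]
      rw [← lintegral_add_left_eq_self
        (fun y => F (e i, y) * ENNReal.ofReal (K (e i) y)) (fun b => (α b : ℂ) * e i b)]
      refine lintegral_congr fun y => ?_
      simp only [Pi.mul_apply, K, Pi.add_apply, add_sub_cancel_left]
      exact mul_comm _ _
  have hsq (b : Fin B) : √(α b ^ 2) = α b := Real.sqrt_sq (hα b)
  have hsum := channelInfo_pi hl
  change channelInfo _ (fun i => K (e i)) = _ at hsum
  change 1 / (B : ℝ) * ((InformationTheory.klDiv _ _).toReal / Real.log 2) = _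
  simp only [blockInfo, hsq]
  change 1 / (B : ℝ) * ((InformationTheory.klDiv (channelLaw (Set.range e) γ α) _).toReal /
    Real.log 2) = _
  rw [key, hsum, one_div_mul_eq_div, div_div, mul_comm (B : ℝ)]

end BlockFadingChannel

/-! ### Sums of functions with diminishing increments -/

section DiminishingReturns

variable {β : Type*} {f : ℝ → ℝ}

lemma apply_sum_le_sum_apply (h0 : f 0 = 0)
    (hf : ∀ s u v : ℝ, 0 ≤ s → 0 ≤ u → 0 ≤ v → f (s + u + v) + f s ≤ f (s + u) + f (s + v))
    (s : Finset β) {t : β → ℝ} (ht : ∀ b, 0 ≤ t b) : f (∑ b ∈ s, t b) ≤ ∑ b ∈ s, f (t b) := by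
  classical
  induction s using Finset.induction_on with
  | empty => simp [h0]
  | insert b s hb ih =>
    rw [Finset.sum_insert hb, Finset.sum_insert hb]
    have := hf 0 (t b) (∑ b ∈ s, t b) le_rfl (ht b) (Finset.sum_nonneg fun b _ => ht b)
    simp only [zero_add, h0] at this
    linarith

/-- Jensen's inequality with equal weights, without any continuity: a value `t i ≤ m` and a value
`t j ≥ m` may be replaced by `m` and `t i + t j - m` without decreasing the sum. -/
lemma sum_apply_le_card_mul_apply
    (hf : ∀ s u v : ℝ, 0 ≤ s → 0 ≤ u → 0 ≤ v → f (s + u + v) + f s ≤ f (s + u) + f (s + v))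
    (s : Finset β) {t : β → ℝ} (ht : ∀ b ∈ s, 0 ≤ t b) {m : ℝ}
    (hm : ∑ b ∈ s, t b = s.card * m) : ∑ b ∈ s, f (t b) ≤ s.card * f m := by
  classical
  induction hn : s.card generalizing s t with
  | zero => simp [Finset.card_eq_zero.1 hn]
  | succ n ih =>
    rw [hn] at hm
    push_cast at hm ⊢
    have hne : s.Nonempty := Finset.card_pos.1 (by omega)
    obtain ⟨i, hi, him⟩ : ∃ i ∈ s, t i ≤ m := by
      refine Finset.exists_le_of_sum_le hne ?_
      rw [hm, Finset.sum_const, hn, nsmul_eq_mul]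
      push_cast
      rfl
    have hcard : (s.erase i).card = n := by rw [Finset.card_erase_of_mem hi, hn]; rfl
    have hsum := Finset.add_sum_erase s t hi
    have hsumf := Finset.add_sum_erase s (fun b => f (t b)) hi
    rcases (s.erase i).eq_empty_or_nonempty with he | he
    · rw [he, Finset.card_empty] at hcard
      subst hcard
      rw [he, Finset.sum_empty, hm] at hsum
      rw [he, Finset.sum_empty] at hsumf
      have : t i = m := by simpa using hsum
      simp only [this] at hsumf
      rw [← hsumf]
      simp
    obtain ⟨j, hj, hmj⟩ : ∃ j ∈ s.erase i, m ≤ t j := by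
      refine Finset.exists_le_of_sum_le he ?_
      rw [Finset.sum_const, hcard, nsmul_eq_mul]
      linarith
    have hsumj := Finset.add_sum_erase (s.erase i) t hj
    have hsumfj := Finset.add_sum_erase (s.erase i) (fun b => f (t b)) hj
    let t' : β → ℝ := Function.update t j (t i + t j - m)
    have ht'j : t' j = t i + t j - m := Function.update_self ..
    have ht' (b : β) (hb : b ∈ (s.erase i).erase j) : t' b = t b :=
      Function.update_of_ne (Finset.ne_of_mem_erase hb) ..
    have hnn : 0 ≤ t i := ht i hi
    have hsum' := Finset.add_sum_erase (s.erase i) t' hj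
    have hsumf' := Finset.add_sum_erase (s.erase i) (fun b => f (t' b)) hj
    rw [Finset.sum_congr rfl ht', ht'j] at hsum'
    rw [Finset.sum_congr rfl (fun b hb => by rw [ht' b hb]), ht'j] at hsumf'
    have hrec := ih (s.erase i) (t := t') (fun b hb => by
      by_cases hbj : b = j
      · rw [hbj, ht'j]; linarith
      · rw [ht' b (Finset.mem_erase.2 ⟨hbj, hb⟩)]
        exact ht b (Finset.mem_of_mem_erase hb)) (by rw [hcard]; linarith) hcard
    have hsw := hf (t i) (m - t i) (t j - m) hnn (by linarith) (by linarith)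
    rw [show t i + (m - t i) + (t j - m) = t j by ring, show t i + (m - t i) = m by ring,
      show t i + (t j - m) = t i + t j - m by ring] at hsw
    linarith

end DiminishingReturns

/-! ### Outage region and hyperspheres -/

section OutageRegion

/-- A Cartesian product with equal projections consists of the words of length `B` over one
constellation `S`. -/
lemma exists_eq_range_pi {B : ℕ} (hB : 0 < B) {Ω : Set (Fin B → ℂ)} (hfin : Ω.Finite)
    (hne : Ω.Nonempty) (hprod : IsCartesianProduct Ω) (hproj : HasEqualProjections Ω) :
    ∃ S : Set ℂ, S.Finite ∧ S.Nonempty ∧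
      Ω = Set.range fun (x : Fin B → S) b => (x b : ℂ) := by
  obtain ⟨S, rfl⟩ := hprod
  have hS (b : Fin B) : (fun x : Fin B → ℂ => x b) '' Set.univ.pi S = S b :=
    Set.eval_image_univ_pi hne
  have hSS (b b' : Fin B) : S b = S b' := by rw [← hS b, ← hS b', hproj b b']
  refine ⟨S ⟨0, hB⟩, hS ⟨0, hB⟩ ▸ hfin.image _, hS ⟨0, hB⟩ ▸ hne.image _, ?_⟩
  ext x
  simp only [Set.mem_univ_pi, Set.mem_range]
  constructor
  · exact fun h => ⟨fun b => ⟨x b, hSS b ⟨0, hB⟩ ▸ h b⟩, rfl⟩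
  · rintro ⟨y, rfl⟩ b
    exact hSS ⟨0, hB⟩ b ▸ (y b).2

/-- A point that ends a curve whose earlier part stays in `V` is a limit of points of `V`. -/
lemma mem_closure_of_Ico {E : Type*} [TopologicalSpace E] {g : ℝ → E} (hg : Continuous g) {a : ℝ}
    (ha : 0 < a) {V : Set E} (hV : ∀ t ∈ Set.Ico 0 a, g t ∈ V) : g a ∈ closure V := by
  have h : a ∈ closure (Set.Ico 0 a) := by
    rw [closure_Ico ha.ne]
    exact ⟨ha.le, le_rfl⟩
  exact closure_mono (Set.image_subset_iff.2 hV)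
    (image_closure_subset_closure_image hg ⟨a, h, rfl⟩)

lemma sum_apply_axisPoint_sq {B : ℕ} {f : ℝ → ℝ} (h0 : f 0 = 0) (b : Fin B) (a : ℝ) :
    ∑ b', f (axisPoint b a b' ^ 2) = f (a ^ 2) := by
  rw [Finset.sum_eq_single b]
  · simp [axisPoint]
  · intro b' _ hb'
    simp [axisPoint, Pi.single_eq_of_ne hb', h0]
  · simp

lemma axisPoint_mem_fadingSpace {B : ℕ} (b : Fin B) {a : ℝ} (ha : 0 ≤ a) :
    axisPoint b a ∈ fadingSpace B := by
  intro b'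
  by_cases h : b' = b
  · subst h; simpa [axisPoint] using ha
  · simp [axisPoint, Pi.single_eq_of_ne h]

end OutageRegion

end BlockFading

open BlockFading

theorem proposition3 (B : ℕ) (hB : 0 < B)
    (Ω : Set (Fin B → ℂ)) (hfin : Ω.Finite) (hne : Ω.Nonempty)
    (hprod : BlockFading.IsCartesianProduct Ω) (hproj : BlockFading.HasEqualProjections Ω)
    (γ R : ℝ) (hγ : 0 < γ) (hR : 0 < R) :
    (∀ (b₀ : Fin B) (αo : ℝ),
      BlockFading.axisPoint b₀ αo ∈ BlockFading.outageBoundary Ω γ R →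
        BlockFading.OuterBounds (αo ^ 2) (BlockFading.outageRegion Ω γ R) ∧
        ∀ b : Fin B,
          BlockFading.TouchesAt Ω γ R (αo ^ 2) (BlockFading.axisPoint b αo)) ∧
    (∀ αe : ℝ,
      BlockFading.ergodicPoint B αe ∈ BlockFading.outageBoundary Ω γ R →
        BlockFading.InnerBounds ((B : ℝ) * αe ^ 2) (BlockFading.outageRegion Ω γ R) ∧
        BlockFading.TouchesAt Ω γ R ((B : ℝ) * αe ^ 2) (BlockFading.ergodicPoint B αe)) := by
  obtain ⟨S, hSfin, hSne, rfl⟩ := exists_eq_range_pi hB hfin hne hprod hproj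
  have : Fintype S := hSfin.fintype
  have : Nonempty S := hSne.to_subtype
  set Ω : Set (Fin B → ℂ) := Set.range fun (x : Fin B → S) b => (x b : ℂ)
  let f : ℝ → ℝ := blockInfo γ (Subtype.val : S → ℂ)
  have hf0 : f 0 = 0 := blockInfo_zero hγ _
  have hf : ∀ s u v : ℝ, 0 ≤ s → 0 ≤ u → 0 ≤ v → f (s + u + v) + f s ≤ f (s + u) + f (s + v) :=
    fun s u v hs hu hv => blockInfo_add_le hγ _ hs hu hv
  have hBpos : (0 : ℝ) < B := by exact_mod_cast hB
  have hden : 0 < B * Real.log 2 := mul_pos hBpos (Real.log_pos one_lt_two)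
  let C : ℝ := R * (B * Real.log 2)
  have hC : 0 < C := mul_pos hR hden
  have hlt {α : Fin B → ℝ} (hα : α ∈ fadingSpace B) :
      α ∈ outageRegion Ω γ R ↔ ∑ b, f (α b ^ 2) < C := by
    change (_ ∧ instMutualInfo Ω γ α < R) ↔ _
    rw [instMutualInfo_eq hγ Subtype.val_injective hα, div_lt_iff₀ hden]
    exact and_iff_right hα
  have heq {α : Fin B → ℝ} (hα : α ∈ fadingSpace B) :
      α ∈ outageBoundary Ω γ R ↔ ∑ b, f (α b ^ 2) = C := by
    change (_ ∧ instMutualInfo Ω γ α = R) ↔ _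
    rw [instMutualInfo_eq hγ Subtype.val_injective hα, div_eq_iff hden.ne']
    exact and_iff_right hα
  -- A one-point constellation carries no information, so its outage boundary is empty.
  have hmono {α : Fin B → ℝ} (hα : α ∈ outageBoundary Ω γ R) : StrictMonoOn f (Set.Ici 0) := by
    rcases subsingleton_or_nontrivial S with h | h
    · have := (heq hα.1).1 hα
      simp only [f, blockInfo_eq_zero_of_subsingleton hγ, Finset.sum_const_zero] at this
      exact absurd this hC.ne
    · exact strictMonoOn_blockInfo hγ Subtype.val_injective
  refine ⟨fun b₀ αo hbd => ?_, fun αe hbd => ?_⟩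
  · have hαo : 0 ≤ αo := by simpa [axisPoint] using hbd.1 b₀
    have hfmono := hmono hbd
    have hfC : f (αo ^ 2) = C := by
      rw [← (heq hbd.1).1 hbd, sum_apply_axisPoint_sq hf0]
    have hpos : 0 < αo := by
      refine hαo.lt_of_ne fun h => hC.ne ?_
      rw [← hfC, ← h, zero_pow two_ne_zero, hf0]
    refine ⟨fun α hα => ⟨hα.1, ?_⟩, fun b => ⟨⟨axisPoint_mem_fadingSpace b hαo, ?_⟩, ?_, ?_⟩⟩
    · by_contra! hle
      have h1 := hfmono.monotoneOn (sq_nonneg αo)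
        (Finset.sum_nonneg fun b _ => sq_nonneg (α b)) hle
      have h2 := apply_sum_le_sum_apply hf0 hf Finset.univ fun b => sq_nonneg (α b)
      have h3 := (hlt hα.1).1 hα
      linarith
    · exact sum_apply_axisPoint_sq (f := fun x => x) rfl b αo
    · rw [heq (axisPoint_mem_fadingSpace b hαo), sum_apply_axisPoint_sq hf0, hfC]
    · refine mem_closure_of_Ico (g := axisPoint b) (continuous_single b) hpos fun t ht => ?_
      rw [hlt (axisPoint_mem_fadingSpace b ht.1), sum_apply_axisPoint_sq hf0, ← hfC]
      exact hfmono (sq_nonneg t) (sq_nonneg αo) (pow_lt_pow_left₀ ht.2 ht.1 two_ne_zero)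
  · have hαe : 0 ≤ αe := hbd.1 ⟨0, hB⟩
    have hfmono := hmono hbd
    have hfC : B * f (αe ^ 2) = C := by
      rw [← (heq hbd.1).1 hbd]
      simp [ergodicPoint]
    have hpos : 0 < αe := by
      refine hαe.lt_of_ne fun h => hC.ne ?_
      rw [← hfC, ← h, zero_pow two_ne_zero, hf0, mul_zero]
    refine ⟨fun α hα => ?_, ⟨hbd.1, by simp [ergodicPoint]⟩, hbd, ?_⟩
    · have h1 := sum_apply_le_card_mul_apply hf Finset.univ (t := fun b => α b ^ 2)
        (fun b _ => sq_nonneg (α b)) (m := (∑ b, α b ^ 2) / B)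
        (by rw [Finset.card_univ, Fintype.card_fin, mul_div_cancel₀ _ hBpos.ne'])
      rw [Finset.card_univ, Fintype.card_fin] at h1
      have h2 : f ((∑ b, α b ^ 2) / B) < f (αe ^ 2) :=
        hfmono (div_nonneg (Finset.sum_nonneg fun b _ => sq_nonneg (α b)) hBpos.le)
          (sq_nonneg αe) ((div_lt_iff₀' hBpos).2 hα.2)
      rw [hlt hα.1, ← hfC]
      exact h1.trans_lt (mul_lt_mul_of_pos_left h2 hBpos)
    · refine mem_closure_of_Ico (g := ergodicPoint B) (by unfold ergodicPoint; fun_prop) hpos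
        fun t ht => ?_
      rw [hlt (α := ergodicPoint B t) fun _ => ht.1, ← hfC]
      have := hfmono (sq_nonneg t) (sq_nonneg αe) (pow_lt_pow_left₀ ht.2 ht.1 two_ne_zero)
      simpa [ergodicPoint] using mul_lt_mul_of_pos_left this hBpos
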